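/- For an integer $m\ge 2$, the multi-cross ladder graph $\mathrm{MCL}_{4m,2}$ is the simple graph with the $8m$ vertices $x_i^{r,s}$ ($i\in\mathbb Z_{2m}$, $r,s\in\mathbb Z_2$) and edge set $$\{\{x_{2i}^{r,s},x_{2i+1}^{r,t}\},\ \{x_{2i+1}^{r,s},x_{2i+2}^{s,r}\} \mid i\in\mathbb Z_m,\ r,s,t\in\mathbb Z_2\}.$$ A graph is called a Cayley graph if it is isomorphic to a graph $\mathrm{Cay}(G,S)$ with vertex set $G$ and edge set $\{\{g,sg\}\mid g\in G,\ s\in S\}$, where $G$ is a finite group and $S\subseteq G\setminus\{1\}$ is closed under inverses; a graph is vertex-transitive if its automorphism group acts transitively on its vertices. Theorem 1.2. Let $m\ge 2$ be an integer. The graph $\mathrm{MCL}_{4m,2}$ is a Cayley graph if and only if either $m$ is even, or $m$ is odd and $3\mid m$. If $m$ is odd and $3\nmid m$, then $\mathrm{MCL}_{4m,2}$ is vertex-transitive and is not a Cayley graph. -/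

import Mathlib

universe u

/-- A graph is vertex-transitive if its automorphism group acts transitively on the vertices. -/
def SimpleGraph.IsVertexTransitive {V : Type u} (Γ : SimpleGraph V) : Prop :=
  ∀ u v : V, ∃ φ : Γ ≃g Γ, φ u = v

/-- A graph is a Cayley graph if it is isomorphic to the Cayley graph of a finite group `H`
with respect to some inverse-closed subset `S` of `H \ {1}`. (Mathlib's `mulCayley` joins `h` to
`h * s`; joining `h` to `s * h` instead gives an isomorphic graph, via `h ↦ h⁻¹`.) -/
def SimpleGraph.IsCayley {V : Type u} (Γ : SimpleGraph V) : Prop :=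
  ∃ (H : Type u) (_ : Group H) (_ : Finite H) (S : Set H),
    (1 : H) ∉ S ∧ (∀ s ∈ S, s⁻¹ ∈ S) ∧ Nonempty (Γ ≃g SimpleGraph.mulCayley S)

/-- The vertices `x_i^{r,s}` of the multi-cross ladder graph, `i ∈ ℤ/2m`, `r, s ∈ ℤ/2`;
the vertex `x_i^{r,s}` is the triple `(i, r, s)`. -/
abbrev MCLVertex (m : ℕ) : Type := ZMod (2 * m) × ZMod 2 × ZMod 2

/-- The multi-cross ladder graph `MCL_{4m,2}` (for `m ≥ 2`), with edges
`{x_{2i}^{r,s}, x_{2i+1}^{r,t}}` and `{x_{2i+1}^{r,s}, x_{2i+2}^{s,r}}`. -/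
def multiCrossLadder (m : ℕ) : SimpleGraph (MCLVertex m) :=
  SimpleGraph.fromEdgeSet
    ({e | ∃ (i : Fin m) (r s t : ZMod 2),
        e = s(((2 * (i : ℕ) : ZMod (2 * m)), r, s), ((2 * (i : ℕ) + 1 : ZMod (2 * m)), r, t))} ∪
     {e | ∃ (i : Fin m) (r s : ZMod 2),
        e = s(((2 * (i : ℕ) + 1 : ZMod (2 * m)), r, s), ((2 * (i : ℕ) + 2 : ZMod (2 * m)), s, r))})

open SimpleGraph

/-! The ladder is a ring of `m` blocks, the block at positions `2k`, `2k+1` being two copies of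
`K_{2,2}` told apart by `r`; adjacent blocks are joined by a perfect matching that swaps `r` and
`s`. The dihedral group acts regularly on the positions (`twist`), and the two copies in any block
may be exchanged: a block constant `f` is added to `r`, and its value on the adjacent block to `s`.
These automorphisms (`shiftIso`) give vertex-transitivity. They contain a regular group once some
`twist`-invariant group of four functions `f` is parametrized by the values on two adjacent blocks
(`isCayley_of_addSubgroup`): functions of period two in the block if `m` is even, those of period
three with sum zero if `3 ∣ m`.

Conversely, for `m ≥ 3` every automorphism preserves the `K_{2,2}`'s, hence commutes with `cross`
and `opp`. In a regular group these two become right multiplications by some `c` and `a`; with `b =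
c * a * c`, the vertices at the position of the identity are `1, a, b, b * a`. If `x` is a rung
neighbour of `1`, conjugation by `x * c` permutes `a, b, a * b` as a transposition or a 3-cycle. But
`(x * c) ^ m` goes once round the ring, so it is one of those four elements and commutes with `a`.
For odd `m` this forces a 3-cycle and `3 ∣ m`. -/

/-- A graph with a group of automorphisms acting regularly on its vertices is a Cayley graph. -/
theorem SimpleGraph.IsCayley.of_regular {V : Type u} [Finite V] {Γ : SimpleGraph V}
    (H : Subgroup (Γ ≃g Γ)) (o : V) (hH : ∀ v, ∃! φ : Γ ≃g Γ, φ ∈ H ∧ φ o = v) :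
    Γ.IsCayley := by
  have hinj : Function.Injective (fun φ : H => φ.1 o) := fun φ ψ h =>
    Subtype.ext ((hH (φ.1 o)).unique ⟨φ.2, rfl⟩ ⟨ψ.2, h.symm⟩)
  have hsurj : Function.Surjective (fun φ : H => φ.1 o) := fun v => by
    obtain ⟨φ, hφ, h⟩ := (hH v).exists
    exact ⟨⟨φ, hφ⟩, h⟩
  have hadj : ∀ φ ψ : H, Γ.Adj (φ.1 o) (ψ.1 o) ↔ Γ.Adj o ((φ⁻¹ * ψ).1 o) := fun φ ψ => by
    rw [← (φ⁻¹).1.map_adj_iff]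
    simp
  have hsymm : ∀ φ : H, Γ.Adj o (φ.1 o) → Γ.Adj o (φ⁻¹.1 o) := fun φ h => by
    have := (hadj φ 1).1 (by simpa using h.symm)
    simpa using this
  refine ⟨H, inferInstance, Finite.of_injective _ hinj, {φ | Γ.Adj o (φ.1 o)}, ?_, hsymm, ⟨?_⟩⟩
  · simp
  · refine RelIso.symm ⟨Equiv.ofBijective _ ⟨hinj, hsurj⟩, ?_⟩
    intro φ ψ
    rw [mulCayley_adj']
    refine (hadj φ ψ).trans ⟨?_, ?_⟩
    · intro h
      exact ⟨fun e => by simp [e] at h, φ⁻¹ * ψ, h, Or.inl (mul_inv_cancel_left φ ψ)⟩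
    · rintro ⟨-, g, hg, rfl | rfl⟩
      · rwa [inv_mul_cancel_left]
      · rw [mul_inv_rev, inv_mul_cancel_right]
        exact hsymm g hg

/-! ### Signs of positions and adjacency -/

namespace MultiCrossLadder

variable {m : ℕ}

/-- The parity of an element of `ℤ/2m`. -/
def parity : ZMod (2 * m) →+* ZMod 2 := ZMod.castHom (dvd_mul_right 2 m) (ZMod 2)

/-- The sign `1` at even and `-1` at odd elements of `ℤ/2m`. -/
def sgn (i : ZMod (2 * m)) : ZMod (2 * m) := if parity i = 0 then 1 else -1

lemma sgn_eq_or (i : ZMod (2 * m)) : sgn i = 1 ∨ sgn i = -1 := by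
  unfold sgn; split_ifs <;> simp

lemma sgn_mul_self (i : ZMod (2 * m)) : sgn i * sgn i = 1 := by
  rcases sgn_eq_or i with h | h <;> simp [h]

lemma sgn_add (i j : ZMod (2 * m)) : sgn (i + j) = sgn i * sgn j := by
  have h2 : ∀ a : ZMod 2, a = 0 ∨ a = 1 := by decide
  have h11 : (1 + 1 : ZMod 2) = 0 := rfl
  unfold sgn
  rcases h2 (parity i) with h | h <;> rcases h2 (parity j) with h' | h' <;>
    simp [h, h', h11]

@[simp] lemma sgn_zero : sgn (0 : ZMod (2 * m)) = 1 := by simp [sgn]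

@[simp] lemma sgn_one : sgn (1 : ZMod (2 * m)) = -1 := by simp [sgn]

@[simp] lemma sgn_neg (i : ZMod (2 * m)) : sgn (-i) = sgn i := by
  simp [sgn]

@[simp] lemma sgn_sgn (i : ZMod (2 * m)) : sgn (sgn i) = -1 := by
  rcases sgn_eq_or i with h | h <;> simp [h]

@[simp] lemma sgn_sgn_mul (i j : ZMod (2 * m)) : sgn (sgn i * j) = sgn j := by
  rcases sgn_eq_or i with h | h <;> simp [h]

@[simp] lemma sgn_sub (i j : ZMod (2 * m)) : sgn (i - j) = sgn i * sgn j := by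
  rw [sub_eq_add_neg, sgn_add, sgn_neg]

attribute [simp] sgn_add

lemma sgn_two_mul (i : ZMod (2 * m)) : sgn (2 * i) = 1 := by
  rw [_root_.two_mul i, sgn_add, sgn_mul_self]

lemma sgn_ne_zero (hm : 2 ≤ m) (i : ZMod (2 * m)) : sgn i ≠ 0 := by
  have : Fact (1 < 2 * m) := ⟨by omega⟩
  rcases sgn_eq_or i with h | h <;> simp [h]

lemma four_ne_zero (hm : 3 ≤ m) : (4 : ZMod (2 * m)) ≠ 0 := fun h => by
  have := (ZMod.natCast_eq_zero_iff 4 (2 * m)).1 (by exact_mod_cast h)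
  have := Nat.le_of_dvd (by norm_num) this
  omega

lemma two_ne_zero (hm : 2 ≤ m) : (2 : ZMod (2 * m)) ≠ 0 := fun h => by
  have := (ZMod.natCast_eq_zero_iff 2 (2 * m)).1 (by exact_mod_cast h)
  have := Nat.le_of_dvd (by norm_num) this
  omega

lemma exists_fin (hm : 2 ≤ m) (j : ZMod (2 * m)) :
    ∃ i : Fin m, (sgn j = 1 ∧ j = 2 * (i : ℕ)) ∨ (sgn j = -1 ∧ j = 2 * (i : ℕ) + 1) := by
  have : NeZero (2 * m) := ⟨by omega⟩
  have hj := ZMod.val_lt j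
  refine ⟨⟨j.val / 2, by omega⟩, ?_⟩
  have hv : ((j.val : ℕ) : ZMod (2 * m)) = j := ZMod.natCast_zmod_val j
  rcases Nat.mod_two_eq_zero_or_one j.val with h | h
  · have e : j = 2 * ((j.val / 2 : ℕ) : ZMod (2 * m)) := by
      conv_lhs => rw [← hv, ← Nat.div_add_mod j.val 2, h]
      push_cast; ring
    exact Or.inl ⟨by rw [e, sgn_two_mul], e⟩
  · have e : j = 2 * ((j.val / 2 : ℕ) : ZMod (2 * m)) + 1 := by
      conv_lhs => rw [← hv, ← Nat.div_add_mod j.val 2, h]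
      push_cast; ring
    exact Or.inr ⟨by rw [e, sgn_add, sgn_two_mul, sgn_one, one_mul], e⟩

/-- The relation of being joined by an edge of one of the `K_{2,2}`'s. -/
def Rung (v w : MCLVertex m) : Prop := w.1 = v.1 + sgn v.1 ∧ w.2.1 = v.2.1

/-- The other end of the crossing edge at a vertex. -/
def cross (v : MCLVertex m) : MCLVertex m := (v.1 - sgn v.1, v.2.2, v.2.1)

lemma Rung.symm {v w : MCLVertex m} (h : Rung v w) : Rung w v := by
  obtain ⟨h1, h2⟩ := h
  refine ⟨?_, h2.symm⟩
  rcases sgn_eq_or v.1 with h | h <;> simp [h1, h]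

@[simp] lemma cross_cross (v : MCLVertex m) : cross (cross v) = v := by
  obtain ⟨i, r, s⟩ := v
  rcases sgn_eq_or i with h | h <;> simp [cross, h]

/-- With `sgn`, even and odd positions are treated alike: a rung moves by `sgn i`, a crossing edge
by `-sgn i`. -/
theorem adj_iff (hm : 2 ≤ m) (v w : MCLVertex m) :
    (multiCrossLadder m).Adj v w ↔ Rung v w ∨ w = cross v := by
  have h2 : ∀ i : Fin m, sgn (2 * (i : ℕ) : ZMod (2 * m)) = 1 := fun i => sgn_two_mul _
  have h22 : sgn (2 : ZMod (2 * m)) = 1 := by simpa using sgn_two_mul (1 : ZMod (2 * m))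
  unfold multiCrossLadder
  rw [fromEdgeSet_adj]
  constructor
  · rintro ⟨⟨i, r, s, t, h⟩ | ⟨i, r, s, h⟩, -⟩ <;> rw [Sym2.eq_iff] at h
    · rcases h with ⟨rfl, rfl⟩ | ⟨rfl, rfl⟩ <;> left <;> simp [Rung, h2]
    · have e : (2 * (i : ℕ) + 1 + 1 : ZMod (2 * m)) = 2 * (i : ℕ) + 2 := by ring
      have e' : (2 * (i : ℕ) + 1 : ZMod (2 * m)) = 2 * (i : ℕ) + 2 - 1 := by ring
      rcases h with ⟨rfl, rfl⟩ | ⟨rfl, rfl⟩ <;> right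
      · simp [cross, h2, e]
      · simp [cross, h2, h22, e']
  · intro h
    refine ⟨?_, ?_⟩
    · obtain ⟨i, r, s⟩ := v
      rcases h with h | rfl
      · obtain ⟨i', r', s'⟩ := w
        obtain ⟨h1, h3⟩ := h
        rcases exists_fin hm i with ⟨k, ⟨hk, e⟩ | ⟨hk, e⟩⟩
        · refine Or.inl ⟨k, r, s, s', ?_⟩
          simp_all
        · refine Or.inl ⟨k, r, s', s, ?_⟩
          rw [Sym2.eq_swap]
          simp_all
      · rcases exists_fin hm i with ⟨k, ⟨hk, e⟩ | ⟨hk, e⟩⟩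
        · rcases exists_fin hm (i - 1) with ⟨l, ⟨hl, e'⟩ | ⟨hl, e'⟩⟩
          · rw [sgn_sub, sgn_one, hk] at hl
            exact absurd (by linear_combination -hl) (two_ne_zero hm)
          · have e1 : i = 2 * (l : ℕ) + 2 := by linear_combination e'
            refine Or.inr ⟨l, s, r, ?_⟩
            rw [Sym2.eq_swap]
            simp [cross, hk, e', ← e1]
        · refine Or.inr ⟨k, r, s, ?_⟩
          have e1 : i + 1 = 2 * (k : ℕ) + 2 := by linear_combination e
          simp [cross, hk, ← e, ← e1]
    · rintro rfl
      rcases h with h | h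
      · exact sgn_ne_zero hm v.1 (by simpa using h.1)
      · have := congrArg Prod.fst h
        exact sgn_ne_zero hm v.1 (by simpa [cross] using this.symm)

/-! ### Dihedral translations, block shifts and vertex-transitivity -/

/-- The left translations of the dihedral group structure on `ℤ/2m` that fits the ladder. -/
def twist (j i : ZMod (2 * m)) : ZMod (2 * m) := j + sgn j * i

@[simp] lemma sgn_twist (j i : ZMod (2 * m)) : sgn (twist j i) = sgn j * sgn i := by
  simp [twist]

lemma twist_add_sgn (j i : ZMod (2 * m)) :
    twist j (i + sgn i) = twist j i + sgn (twist j i) := by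
  rw [sgn_twist]; unfold twist; ring

lemma twist_sub_sgn (j i : ZMod (2 * m)) :
    twist j (i - sgn i) = twist j i - sgn (twist j i) := by
  rw [sgn_twist]; unfold twist; ring

lemma twist_twist (j k i : ZMod (2 * m)) : twist j (twist k i) = twist (twist j k) i := by
  rw [twist, twist, twist, sgn_twist, twist]; ring

lemma twist_zero_left (i : ZMod (2 * m)) : twist 0 i = i := by simp [twist]

lemma twist_zero_right (j : ZMod (2 * m)) : twist j 0 = j := by simp [twist]

lemma twist_left_inv (j : ZMod (2 * m)) : twist (-(sgn j * j)) j = 0 := by simp [twist]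

lemma twist_right_inv (j : ZMod (2 * m)) : twist j (-(sgn j * j)) = 0 := by
  simp [twist, ← mul_assoc, sgn_mul_self]

lemma twist_inv_twist (j i : ZMod (2 * m)) : twist (-(sgn j * j)) (twist j i) = i := by
  rw [twist_twist, twist_left_inv, twist_zero_left]

lemma twist_twist_inv (j i : ZMod (2 * m)) : twist j (twist (-(sgn j * j)) i) = i := by
  rw [twist_twist, twist_right_inv, twist_zero_left]

/-- A function on `ℤ/2m` is block constant if it takes one value on each `K_{2,2}` position. -/
def BlockConst (f : ZMod (2 * m) → ZMod 2) : Prop := ∀ i, f (i + sgn i) = f i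

lemma BlockConst.twist {f : ZMod (2 * m) → ZMod 2} (hf : BlockConst f) (j : ZMod (2 * m)) :
    BlockConst fun i => f (twist j i) := fun i => by
  simp only [twist_add_sgn, hf _]

/-- The map `(i, r, s) ↦ (j * i, r + f i, s + f i')` with `i'` the neighbouring position of `i`. -/
def shiftFun (j : ZMod (2 * m)) (f : ZMod (2 * m) → ZMod 2) (v : MCLVertex m) : MCLVertex m :=
  (twist j v.1, v.2.1 + f v.1, v.2.2 + f (v.1 - sgn v.1))

/-- `shiftFun` as an automorphism of the multi-cross ladder graph. -/
def shiftIso (hm : 2 ≤ m) (j : ZMod (2 * m)) (f : ZMod (2 * m) → ZMod 2) (hf : BlockConst f) :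
    multiCrossLadder m ≃g multiCrossLadder m where
  toFun := shiftFun j f
  invFun := shiftFun (-(sgn j * j)) fun i => f (twist (-(sgn j * j)) i)
  left_inv v := by
    simp only [shiftFun, ← twist_sub_sgn, twist_inv_twist, add_assoc, CharTwo.add_self_eq_zero,
      add_zero]
  right_inv v := by
    simp [shiftFun, twist_twist_inv, twist_sub_sgn, add_assoc, CharTwo.add_self_eq_zero]
  map_rel_iff' := by
    intro v w
    have hinj : ∀ i i', twist j i = twist j i' ↔ i = i' := fun i i' =>
      (Function.LeftInverse.injective (twist_inv_twist j)).eq_iff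
    simp only [adj_iff hm, Equiv.coe_fn_mk, Rung, shiftFun, cross, Prod.ext_iff, hinj,
      ← twist_add_sgn, ← twist_sub_sgn]
    refine or_congr (and_congr_right fun h => ?_) (and_congr_right fun h => ?_)
    · rw [h, hf, add_left_inj]
    · rw [h]
      have : v.1 - sgn v.1 - sgn (v.1 - sgn v.1) = v.1 := congrArg Prod.fst (cross_cross v)
      rw [this, add_left_inj, add_left_inj]

lemma shiftIso_apply (hm : 2 ≤ m) (j : ZMod (2 * m)) (f : ZMod (2 * m) → ZMod 2)
    (hf : BlockConst f) (v : MCLVertex m) : shiftIso hm j f hf v =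
      (twist j v.1, v.2.1 + f v.1, v.2.2 + f (v.1 - sgn v.1)) := rfl

theorem isVertexTransitive (hm : 2 ≤ m) : (multiCrossLadder m).IsVertexTransitive := by
  have key : ∀ v : MCLVertex m, ∃ φ : multiCrossLadder m ≃g multiCrossLadder m, φ 0 = v := by
    rintro ⟨j, r, s⟩
    have h2 : (2 : ZMod (2 * m)) ≠ 0 := two_ne_zero hm
    have h2' : (-1 : ZMod (2 * m)) ≠ 1 := fun h => h2 (by linear_combination -h)
    have h3 : (-1 : ZMod (2 * m)) ≠ 0 := fun h => h2 (by linear_combination -2 * h)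
    have : ∀ i : ZMod (2 * m), (i + sgn i = 0 ∨ i + sgn i = 1) ↔ (i = 0 ∨ i = 1) := by
      intro i
      constructor
      · rintro (h | h)
        · have hs : sgn (i + sgn i) = 1 := by rw [h, sgn_zero]
          rw [sgn_add, sgn_sgn] at hs
          have : sgn i = -1 := by linear_combination -hs
          exact Or.inr (by linear_combination h - this)
        · have hs : sgn (i + sgn i) = -1 := by rw [h, sgn_one]
          rw [sgn_add, sgn_sgn] at hs
          exact Or.inl (by linear_combination h + hs)
      · rintro (rfl | rfl) <;> simp
    -- The image of `0` depends on `f` only through its values at `0` and at `-1`, and `-1` lies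
    -- outside the block `{0, 1}`.
    have hf : BlockConst fun i : ZMod (2 * m) => if i = 0 ∨ i = 1 then r else s := fun i =>
      if_congr (this i) rfl rfl
    refine ⟨shiftIso hm j _ hf, ?_⟩
    simp [shiftIso_apply, twist_zero_right, h2', h3]
  intro u v
  obtain ⟨φ, rfl⟩ := key u
  obtain ⟨ψ, rfl⟩ := key v
  exact ⟨φ.symm.trans ψ, by simp⟩

/-! ### Regular groups of block shifts -/

/-- The ladder graph is a Cayley graph if some twist invariant group of block constant functions
is parametrized by the values at two neighbouring blocks. -/
theorem isCayley_of_addSubgroup (hm : 2 ≤ m) (N : AddSubgroup (ZMod (2 * m) → ZMod 2))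
    (hblock : ∀ f ∈ N, BlockConst f) (htwist : ∀ f ∈ N, ∀ j, (fun i => f (twist j i)) ∈ N)
    (heval : ∀ r s, ∃! f, f ∈ N ∧ f 0 = r ∧ f (-1) = s) : (multiCrossLadder m).IsCayley := by
  have : NeZero (2 * m) := ⟨by omega⟩
  let H : Subgroup (multiCrossLadder m ≃g multiCrossLadder m) :=
    { carrier := {φ | ∃ j, ∃ f, ∃ hf : f ∈ N, φ = shiftIso hm j f (hblock f hf)}
      one_mem' := by
        refine ⟨0, 0, N.zero_mem, ?_⟩
        ext v <;> simp [shiftIso_apply, twist_zero_left]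
      mul_mem' := by
        rintro _ _ ⟨j, f, hf, rfl⟩ ⟨k, g, hg, rfl⟩
        refine ⟨twist j k, _, N.add_mem hg (htwist f hf k), RelIso.ext fun v => ?_⟩
        simp [shiftIso_apply, twist_twist, twist_sub_sgn, add_assoc]
      inv_mem' := by
        rintro _ ⟨j, f, hf, rfl⟩
        exact ⟨-(sgn j * j), _, htwist f hf _, RelIso.ext fun v => rfl⟩ }
  refine IsCayley.of_regular H 0 ?_
  rintro ⟨j, r, s⟩
  obtain ⟨f, ⟨hf, h0, h1⟩, huniq⟩ := heval r s
  refine ⟨shiftIso hm j f (hblock f hf), ⟨⟨j, f, hf, rfl⟩, ?_⟩, ?_⟩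
  · simp [shiftIso_apply, twist_zero_right, h0, h1]
  · rintro _ ⟨⟨k, g, hg, rfl⟩, h⟩
    simp only [shiftIso_apply, Prod.fst_zero, Prod.snd_zero, twist_zero_right, Prod.mk.injEq,
      zero_add, sgn_zero, zero_sub] at h
    obtain ⟨rfl, rfl, rfl⟩ := h
    obtain rfl := huniq g ⟨hg, rfl, rfl⟩
    rfl

/-- The pullbacks to `ℤ/2m` of a group of functions on `ℤ/2d`. -/
def pullback {d : ℕ} (h : 2 * d ∣ 2 * m) (Q : AddSubgroup (ZMod (2 * d) → ZMod 2)) :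
    AddSubgroup (ZMod (2 * m) → ZMod 2) where
  carrier := {f | ∃ g ∈ Q, f = fun i => g (ZMod.castHom h _ i)}
  zero_mem' := ⟨0, Q.zero_mem, rfl⟩
  add_mem' := by
    rintro _ _ ⟨g, hg, rfl⟩ ⟨g', hg', rfl⟩
    exact ⟨_, Q.add_mem hg hg', rfl⟩
  neg_mem' := by
    rintro _ ⟨g, hg, rfl⟩
    exact ⟨_, Q.neg_mem hg, rfl⟩

lemma castHom_sgn {d : ℕ} (h : 2 * d ∣ 2 * m) (i : ZMod (2 * m)) :
    ZMod.castHom h (ZMod (2 * d)) (sgn i) = sgn (ZMod.castHom h (ZMod (2 * d)) i) := by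
  have : parity (ZMod.castHom h (ZMod (2 * d)) i) = parity i :=
    RingHom.congr_fun (RingHom.ext_zmod (parity.comp (ZMod.castHom h _)) parity) i
  unfold sgn
  rw [this]
  split_ifs
  · exact map_one _
  · rw [map_neg, map_one]

lemma castHom_twist {d : ℕ} (h : 2 * d ∣ 2 * m) (j i : ZMod (2 * m)) :
    ZMod.castHom h (ZMod (2 * d)) (twist j i) =
      twist (ZMod.castHom h (ZMod (2 * d)) j) (ZMod.castHom h (ZMod (2 * d)) i) := by
  simp only [twist, map_add, map_mul, castHom_sgn]

/-- Reduction mod `2 * d` respects `sgn` and `twist`, so a suitable group on the short ring pulls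
back; only `d = 2` and `d = 3` are needed, where finite checks suffice. -/
theorem isCayley_of_dvd {d : ℕ} (hm : 2 ≤ m) (h : d ∣ m)
    (Q : AddSubgroup (ZMod (2 * d) → ZMod 2))
    (hblock : ∀ f ∈ Q, BlockConst f) (htwist : ∀ f ∈ Q, ∀ j, (fun i => f (twist j i)) ∈ Q)
    (heval : ∀ r s, ∃! f, f ∈ Q ∧ f 0 = r ∧ f (-1) = s) : (multiCrossLadder m).IsCayley := by
  have h' : 2 * d ∣ 2 * m := mul_dvd_mul_left 2 h
  refine isCayley_of_addSubgroup hm (pullback h' Q) ?_ ?_ ?_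
  · rintro _ ⟨g, hg, rfl⟩ i
    simp only [map_add, castHom_sgn]
    exact hblock g hg _
  · rintro _ ⟨g, hg, rfl⟩ j
    exact ⟨_, htwist g hg (ZMod.castHom h' _ j), funext fun i => by simp only [castHom_twist]⟩
  · intro r s
    obtain ⟨g, ⟨hg, h0, h1⟩, huniq⟩ := heval r s
    refine ⟨_, ⟨⟨g, hg, rfl⟩, by rwa [map_zero], by rwa [map_neg, map_one]⟩, ?_⟩
    rintro _ ⟨⟨g', hg', rfl⟩, h0', h1'⟩
    beta_reduce at h0' h1'
    rw [map_zero] at h0'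
    rw [map_neg, map_one] at h1'
    rw [huniq g' ⟨hg', h0', h1'⟩]

/-- The block constant functions. -/
def blockConst (d : ℕ) : AddSubgroup (ZMod (2 * d) → ZMod 2) where
  carrier := {f | BlockConst f}
  zero_mem' := fun _ => rfl
  add_mem' := fun hf hg i => by rw [Pi.add_apply, Pi.add_apply, hf, hg]
  neg_mem' := fun hf i => by rw [Pi.neg_apply, Pi.neg_apply, hf]

/-- The block constant functions with sum zero over any three consecutive blocks. -/
def blockConstSumZero (d : ℕ) : AddSubgroup (ZMod (2 * d) → ZMod 2) where
  carrier := {f | BlockConst f ∧ ∀ i, f i + f (i + 2) + f (i + 4) = 0}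
  zero_mem' := ⟨fun _ => rfl, fun _ => by simp⟩
  add_mem' := fun {f g} hf hg => ⟨(blockConst d).add_mem hf.1 hg.1, fun i => by
    simp only [Pi.add_apply]
    linear_combination hf.2 i + hg.2 i⟩
  neg_mem' := fun {f} hf => ⟨(blockConst d).neg_mem hf.1, fun i => by
    simp only [Pi.neg_apply]
    linear_combination -hf.2 i⟩

theorem isCayley_of_two_dvd (hm : 2 ≤ m) (h : 2 ∣ m) : (multiCrossLadder m).IsCayley := by
  refine isCayley_of_dvd hm h (blockConst 2) (fun f hf => hf) (fun f hf j => hf.twist j) ?_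
  intro r s
  refine ⟨fun i => if i = 0 ∨ i = 1 then r else s, ⟨?_, by revert r s; decide⟩, ?_⟩
  · change ∀ i : ZMod (2 * 2), _
    revert r s
    decide
  · rintro f ⟨hf, rfl, rfl⟩
    have h0 := hf 0
    have h1 := hf (-1)
    have hi : ∀ i : ZMod (2 * 2), i = 0 ∨ i = 0 + sgn 0 ∨ i = -1 ∨ i = -1 + sgn (-1) := by decide
    funext i
    rcases hi i with rfl | rfl | rfl | rfl
    · rfl
    · exact h0
    · rfl
    · exact h1

theorem isCayley_of_three_dvd (hm : 2 ≤ m) (h : 3 ∣ m) : (multiCrossLadder m).IsCayley := by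
  refine isCayley_of_dvd hm h (blockConstSumZero 3) (fun f hf => hf.1)
    (fun f hf j => ⟨hf.1.twist j, fun i => ?_⟩) ?_
  · unfold twist
    rcases sgn_eq_or j with hj | hj
    · have := hf.2 (j + i)
      simpa [hj, add_assoc] using this
    -- A reflection reverses the three blocks, so the relation needed is the one starting at the
    -- last of them.
    · have := hf.2 (j - i - 4)
      rw [show j - i - 4 + 2 = j + -1 * (i + 2) by ring, show j - i - 4 + 4 = j + -1 * i by ring,
        show j - i - 4 = j + -1 * (i + 4) by ring] at this
      simp only [hj]
      linear_combination this
  intro r s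
  refine ⟨fun i => if i = 0 ∨ i = 1 then r else if i = 4 ∨ i = 5 then s else r + s,
    ⟨⟨?_, by revert r s; decide⟩, by revert r s; decide⟩, ?_⟩
  · change ∀ i : ZMod (2 * 3), _
    revert r s
    decide
  · rintro f ⟨⟨hf, hsum⟩, rfl, rfl⟩
    have h0 := hf 0
    have h1 := hf (-1)
    have h2 := hf 2
    have e : f 2 = f 0 + f (-1) := by
      -- In `ℤ/6`, `4 = -1 + sgn (-1)` lies in the block of `-1`.
      have h4 : f (0 + 4) = f (-1) := h1
      have := hsum 0
      rw [h4, zero_add] at this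
      have two : (2 : ZMod 2) = 0 := rfl
      linear_combination this - (f 0 + f (-1)) * two
    have hi : ∀ i : ZMod (2 * 3), i = 0 ∨ i = 0 + sgn 0 ∨ i = -1 ∨ i = -1 + sgn (-1) ∨ i = 2 ∨
      i = 2 + sgn 2 := by decide
    funext i
    rcases hi i with rfl | rfl | rfl | rfl | rfl | rfl
    · rfl
    · exact h0
    · rfl
    · exact h1
    · exact e
    · exact h2.trans e

end MultiCrossLadder

/-! ### The group-theoretic obstruction -/

/-- In a group, let `a ≠ b` commute and be swapped by conjugation with `c`, and let `x` commute with
`a` and conjugate `b` to `b` or `b * a`. If an odd power of `x * c` commutes with `a`, then its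
exponent is divisible by three. -/
theorem three_dvd_of_pow_mem {G : Type*} [Group G] {a b c x : G} {m : ℕ} (hm : Odd m)
    (hab : a ≠ b) (hcomm : a * b = b * a) (hbb : b * b = 1) (hca : c * a = b * c) (hcb : c * b = a * c)
    (hx : a * x = x * a) (hbx : b * x = x * b ∨ b * x = x * (b * a))
    (hpow : Commute a ((x * c) ^ m)) : 3 ∣ m := by
  have hne : ¬ Commute a (x * c) := fun h => hab <| by
    have h1 : x * (a * c) = x * (c * a) := by
      rw [← mul_assoc, ← hx, mul_assoc, h.eq, mul_assoc]
    exact mul_right_cancel ((mul_left_cancel h1).trans hca)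
  -- By Bézout, if `k` and `m` were coprime, `x * c` would be a product of powers of its `k`-th and
  -- `m`-th powers, and so commute with `a`.
  have hcop : ∀ k : ℕ, Commute a ((x * c) ^ k) → ¬ Nat.Coprime k m := fun k hk hc => hne <| by
    have := Nat.gcd_eq_gcd_ab k m
    rw [hc] at this
    have e : x * c = ((x * c) ^ k) ^ (k.gcdA m) * ((x * c) ^ m) ^ (k.gcdB m) := by
      rw [← zpow_natCast, ← zpow_natCast, ← zpow_mul, ← zpow_mul, ← zpow_add, ← this]
      simp
    rw [e]
    exact (hk.zpow_right _).mul_right (hpow.zpow_right _)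
  have ha : a * (x * c) = x * c * b := by
    rw [← mul_assoc, hx, mul_assoc, mul_assoc, hcb]
  -- With `y = x * c`, the map `g ↦ y⁻¹ * g * y` sends `a` to `b`, and `b` to `a` or to `a * b`. So
  -- `y ^ 2`, respectively `y ^ 3`, commutes with `a`.
  rcases hbx with h | h
  · have hb : b * (x * c) = x * c * a := by
      rw [← mul_assoc, h, mul_assoc, mul_assoc, hca]
    refine absurd (Nat.coprime_two_left.2 hm) (hcop 2 ?_)
    change a * (x * c) ^ 2 = (x * c) ^ 2 * a
    rw [pow_two, ← mul_assoc, ha, mul_assoc, hb, ← mul_assoc]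
  · have hb : b * (x * c) = x * c * (a * b) := by
      rw [← mul_assoc, h, mul_assoc, mul_assoc, ← hcb, ← mul_assoc b, ← hca, mul_assoc c,
        ← mul_assoc]
    by_contra h3
    refine hcop 3 ?_ ((Nat.Prime.coprime_iff_not_dvd Nat.prime_three).2 h3)
    change a * (x * c) ^ 3 = (x * c) ^ 3 * a
    generalize x * c = y at *
    calc a * y ^ 3 = a * y * y * y := by rw [pow_succ, pow_two]; simp only [mul_assoc]
      _ = y * (b * y) * y := by rw [ha, mul_assoc y]
      _ = y * y * a * (b * y) := by nth_rw 1 [hb]; simp only [mul_assoc]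
      _ = y * y * (a * y) * (a * b) := by rw [hb]; simp only [mul_assoc]
      _ = y * y * y * (b * a * b) := by rw [ha]; simp only [mul_assoc]
      _ = y ^ 3 * a := by rw [← hcomm, mul_assoc a, hbb, mul_one, pow_succ, pow_two]

/-! ### Rigidity of automorphisms and the non-Cayley case -/

namespace MultiCrossLadder

variable {m : ℕ}

/-- A crossing edge lies in no 4-cycle. Its neighbours on the cycle would be rungs, so `q, v, w, p`
would advance in one direction, and closing up by a rung or a crossing edge would give `2 = 0` or `4
= 0` in `ℤ/2m`. The latter is what `m ≥ 3` excludes. -/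
lemma rung_iff_exists_square (hm : 3 ≤ m) (v w : MCLVertex m) : Rung v w ↔
    (multiCrossLadder m).Adj v w ∧ ∃ p q, (multiCrossLadder m).Adj w p ∧
      (multiCrossLadder m).Adj p q ∧ (multiCrossLadder m).Adj q v ∧ p ≠ v ∧ q ≠ w := by
  have hm2 : 2 ≤ m := by omega
  constructor
  · intro h
    refine ⟨(adj_iff hm2 v w).2 (Or.inl h), (v.1, v.2.1, v.2.2 + 1), (w.1, w.2.1, w.2.2 + 1),
      (adj_iff hm2 _ _).2 (Or.inl h.symm), (adj_iff hm2 _ _).2 (Or.inl h),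
      (adj_iff hm2 _ _).2 (Or.inl h.symm), ?_, ?_⟩ <;> simp [Prod.ext_iff]
  · rintro ⟨hvw, p, q, hwp, hpq, hqv, hpv, hqw⟩
    rw [adj_iff hm2] at hvw hwp hpq hqv
    refine hvw.resolve_right ?_
    rintro rfl
    have hwp := hwp.resolve_right (by rwa [cross_cross])
    have hqv := hqv.resolve_right fun h => hqw (by rw [h, cross_cross])
    have hp := hwp.1
    have hq := hqv.symm.1
    rcases hpq with hpq | rfl
    · have := hpq.1
      rw [hp, hq] at this
      refine two_ne_zero hm2 ?_
      rcases sgn_eq_or v.1 with h | h <;> simp [cross, h] at this <;>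
        first | linear_combination this | linear_combination -this
    · change p.1 - sgn p.1 = _ at hq
      rw [hp] at hq
      refine four_ne_zero hm ?_
      rcases sgn_eq_or v.1 with h | h <;> simp [cross, h] at hq <;>
        first | linear_combination hq | linear_combination -hq

lemma Rung.map (hm : 3 ≤ m) (φ : multiCrossLadder m ≃g multiCrossLadder m)
    {v w : MCLVertex m} (h : Rung v w) : Rung (φ v) (φ w) := by
  rw [rung_iff_exists_square hm] at h ⊢
  obtain ⟨hvw, p, q, hwp, hpq, hqv, hpv, hqw⟩ := h
  exact ⟨φ.map_adj_iff.2 hvw, φ p, φ q, φ.map_adj_iff.2 hwp, φ.map_adj_iff.2 hpq,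
    φ.map_adj_iff.2 hqv, φ.injective.ne hpv, φ.injective.ne hqw⟩

lemma map_rung_iff (hm : 3 ≤ m) (φ : multiCrossLadder m ≃g multiCrossLadder m)
    (v w : MCLVertex m) : Rung (φ v) (φ w) ↔ Rung v w :=
  ⟨fun h => by simpa using h.map hm φ.symm, fun h => h.map hm φ⟩

lemma not_rung_cross (hm : 2 ≤ m) (v : MCLVertex m) : ¬ Rung v (cross v) := fun h => by
  have := h.1
  refine two_ne_zero hm ?_
  rcases sgn_eq_or v.1 with h | h <;> simp [cross, h] at this <;>
        first | linear_combination this | linear_combination -this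

lemma map_cross (hm : 3 ≤ m) (φ : multiCrossLadder m ≃g multiCrossLadder m) (v : MCLVertex m) :
    φ (cross v) = cross (φ v) := by
  have hm2 : 2 ≤ m := by omega
  have h := φ.map_adj_iff.2 ((adj_iff hm2 v _).2 (Or.inr rfl))
  rw [adj_iff hm2, map_rung_iff hm] at h
  exact h.resolve_left (not_rung_cross hm2 v)

/-- The vertex opposite to a vertex in its `K_{2,2}`. -/
def opp (v : MCLVertex m) : MCLVertex m := (v.1, v.2.1, v.2.2 + 1)

@[simp] lemma opp_opp (v : MCLVertex m) : opp (opp v) = v := by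
  simp [opp, add_assoc, CharTwo.add_self_eq_zero]

lemma opp_ne (v : MCLVertex m) : opp v ≠ v := by
  simp [opp, Prod.ext_iff]

lemma eq_or_eq_opp {v w : MCLVertex m} (h1 : w.1 = v.1) (h2 : w.2.1 = v.2.1) :
    w = v ∨ w = opp v := by
  have h : ∀ s t : ZMod 2, t = s ∨ t = s + 1 := by decide
  exact (h v.2.2 w.2.2).imp (fun h => Prod.ext h1 (Prod.ext h2 h))
    fun h => Prod.ext h1 (Prod.ext h2 h)

lemma Rung.eq_or_eq_opp {v w w' : MCLVertex m} (h : Rung v w) (h' : Rung v w') :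
    w' = w ∨ w' = opp w :=
  MultiCrossLadder.eq_or_eq_opp (h'.1.trans h.1.symm) (h'.2.trans h.2.symm)

/-- Opposite vertices are the two rung neighbours of a common vertex, a relation that automorphisms
preserve. -/
lemma map_opp (hm : 3 ≤ m) (φ : multiCrossLadder m ≃g multiCrossLadder m) (v : MCLVertex m) :
    φ (opp v) = opp (φ v) := by
  let w : MCLVertex m := (v.1 + sgn v.1, v.2.1, 0)
  have hv : Rung v w := ⟨rfl, rfl⟩
  have hv' : Rung (opp v) w := ⟨rfl, rfl⟩
  refine (Rung.eq_or_eq_opp ((map_rung_iff hm φ _ _).2 hv).symm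
    ((map_rung_iff hm φ _ _).2 hv').symm).resolve_left fun h => opp_ne v (φ.injective h)

lemma not_isCayley (hm : 3 ≤ m) (hodd : Odd m) (h3 : ¬ 3 ∣ m) :
    ¬ (multiCrossLadder m).IsCayley := by
  rintro ⟨H, _, _, S, -, -, ⟨ψ⟩⟩
  -- Left multiplications are automorphisms, so a map commuting with every automorphism is a right
  -- multiplication on `H`.
  let L (g : H) : multiCrossLadder m ≃g multiCrossLadder m :=
    (ψ.trans ⟨Equiv.mulLeft g, mulCayley_adj_mul_iff_right⟩).trans ψ.symm
  have hL : ∀ g h, L g (ψ.symm h) = ψ.symm (g * h) := fun g h => by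
    change ψ.symm (g * ψ (ψ.symm h)) = _
    rw [ψ.apply_symm_apply]
  let o := ψ.symm 1
  have hLo : ∀ g, L g o = ψ.symm g := fun g => by simp [o, hL]
  have hopp : ∀ g, opp (ψ.symm g) = ψ.symm (g * ψ (opp o)) := fun g => by
    rw [← hL, ψ.symm_apply_apply, map_opp hm, hLo]
  have hcross : ∀ g, cross (ψ.symm g) = ψ.symm (g * ψ (cross o)) := fun g => by
    rw [← hL, ψ.symm_apply_apply, map_cross hm, hLo]
  let w : MCLVertex m := (o.1 + sgn o.1, o.2.1, 0)
  have hrung : ∀ g, Rung (ψ.symm g) (ψ.symm (g * ψ w)) := fun g => by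
    rw [← hL, ψ.symm_apply_apply, ← hLo, map_rung_iff hm]
    exact ⟨rfl, rfl⟩
  generalize ψ (opp o) = a at hopp
  generalize ψ (cross o) = c at hcross
  generalize ψ w = x at hrung
  have hb : ∀ g, cross (opp (cross (ψ.symm g))) = ψ.symm (g * (c * a * c)) := fun g => by
    simp only [hcross, hopp, mul_assoc]
  have inj := ψ.symm.injective
  have hcc : c * c = 1 := inj (by
    rw [← one_mul (c * c), ← mul_assoc, ← hcross, ← hcross, cross_cross])
  have hm2 : 2 ≤ m := by omega
  have hopp_comm : ∀ v : MCLVertex m, cross (opp (cross (opp v))) = opp (cross (opp (cross v))) :=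
    fun v => by rcases sgn_eq_or v.1 with h | h <;> simp [cross, opp, h]
  have hcac : a * (c * a * c) = c * a * c * a := by
    apply inj
    have := hopp_comm (ψ.symm 1)
    simp only [hopp, hcross, one_mul] at this
    simpa only [mul_assoc] using this
  have haa : a * a = 1 := inj (by
    rw [← one_mul (a * a), ← mul_assoc, ← hopp, ← hopp, opp_opp])
  -- A rung followed by a crossing edge advances two positions and keeps the parity, so the
  -- direction never changes.
  have hpow : ∀ k : ℕ, (ψ.symm ((x * c) ^ k)).1 = o.1 + k * (2 * sgn o.1) := by
    intro k
    induction k with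
    | zero => simp [o]
    | succ k ih =>
      rw [pow_succ, ← mul_assoc, ← hcross]
      have h := (hrung ((x * c) ^ k)).1
      have hs : sgn (ψ.symm ((x * c) ^ k)).1 = sgn o.1 := by
        rw [ih, sgn_add, mul_left_comm, sgn_two_mul, mul_one]
      rw [hs] at h
      simp only [cross, h]
      rw [sgn_add, hs, sgn_sgn, ih]
      push_cast
      ring
  refine h3 (three_dvd_of_pow_mem (a := a) (b := c * a * c) (c := c) (x := x) hodd ?_ ?_ ?_ ?_ ?_
    ?_ ?_ ?_)
  · intro h
    have := hb 1
    rw [← h, ← hopp] at this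
    simp [cross, opp, Prod.ext_iff] at this
  · exact hcac
  · simp only [mul_assoc]
    rw [← mul_assoc c c, hcc, one_mul, ← mul_assoc a a, haa, one_mul, hcc]
  · simp [mul_assoc, hcc]
  · simp [← mul_assoc, hcc]
  -- Both `x` and `a * x` are rung neighbours of `a`, because `1` and `a` have the same rung
  -- neighbours.
  · have h1 : Rung (ψ.symm a) (ψ.symm x) := by
      have := hrung 1
      rw [one_mul] at this
      rw [← one_mul a, ← hopp]
      exact this
    rcases h1.eq_or_eq_opp (hrung a) with h | h
    · exact absurd (mul_eq_right.1 (inj h)) fun h => opp_ne (ψ.symm 1) (by rw [hopp, h, one_mul])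
    · rw [hopp] at h
      exact inj h
  -- Right multiplication by `b` changes only the coordinate `r`, so it carries the rung from `1` to
  -- `x` to one from `b` to `x * b`; `b * x` is another rung neighbour of `b`.
  · have h1 : Rung (ψ.symm (c * a * c)) (ψ.symm (x * (c * a * c))) := by
      have := hrung 1
      rw [one_mul] at this
      rw [← one_mul (c * a * c), ← hb, one_mul, ← hb]
      rcases sgn_eq_or (ψ.symm 1).1 with h | h <;> simp_all [Rung, cross, opp]
    refine (h1.eq_or_eq_opp (hrung _)).imp (fun h => inj h) fun h => ?_
    rw [hopp] at h
    exact (inj h).trans (mul_assoc _ _ _)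
  -- After `m` steps the position has moved by a multiple of `2 * m`, so `(x * c) ^ m` is `1`, `a`,
  -- `b` or `b * a`, and each of these commutes with `a`.
  · have h1 : (ψ.symm ((x * c) ^ m)).1 = o.1 := by
      rw [hpow, ← mul_assoc, mul_comm (m : ZMod (2 * m))]
      have := ZMod.natCast_self (2 * m)
      push_cast at this
      rw [this, zero_mul, add_zero]
    have hB := hb 1
    rw [one_mul] at hB
    have h2 : ∀ r t : ZMod 2, t = r ∨ t = r + 1 := by decide
    rcases h2 o.2.1 (ψ.symm ((x * c) ^ m)).2.1 with h | h
    · rcases eq_or_eq_opp h1 h with h | h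
      · rw [inj h]
        exact Commute.one_right a
      · rw [hopp, one_mul] at h
        rw [inj h]
    · have hz : ∀ v : MCLVertex m, (cross (opp (cross v))).1 = v.1 ∧
          (cross (opp (cross v))).2.1 = v.2.1 + 1 := fun v => by
        rcases sgn_eq_or v.1 with h | h <;> simp [cross, opp, h]
      rcases eq_or_eq_opp (h1.trans (hz o).1.symm) (h.trans (hz o).2.symm) with h | h
      · rw [hB] at h
        rw [inj h]
        exact hcac
      · rw [hB, hopp] at h
        rw [inj h]
        exact Commute.mul_right hcac (Commute.refl a)

end MultiCrossLadder

theorem theorem1p2 (m : ℕ) (hm : 2 ≤ m) :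
    ((multiCrossLadder m).IsCayley ↔ (Even m ∨ (Odd m ∧ 3 ∣ m))) ∧
    (Odd m → ¬ 3 ∣ m →
      (multiCrossLadder m).IsVertexTransitive ∧ ¬ (multiCrossLadder m).IsCayley) := by
  have hnot : Odd m → ¬ 3 ∣ m → ¬ (multiCrossLadder m).IsCayley := fun hodd h3 => by
    refine MultiCrossLadder.not_isCayley ?_ hodd h3
    obtain ⟨k, rfl⟩ := hodd
    omega
  refine ⟨⟨fun h => ?_, ?_⟩, fun hodd h3 =>
    ⟨MultiCrossLadder.isVertexTransitive hm, hnot hodd h3⟩⟩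
  · rcases Nat.even_or_odd m with he | ho
    · exact Or.inl he
    · exact Or.inr ⟨ho, by_contra fun h3 => hnot ho h3 h⟩
  · rintro (he | ⟨-, h3⟩)
    · exact MultiCrossLadder.isCayley_of_two_dvd hm he.two_dvd
    · exact MultiCrossLadder.isCayley_of_three_dvd hm h3
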